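/- Theorem 3.5 (restated and proved as Theorem 3.11). Let $n\ge 0$ and let $T,S$ be standard Young tableaux with entries $1,\dots,n$ and at most two columns. Then $$T\overset{C}{<}S\quad\Longleftrightarrow\quad w_T\overset{D}{<}w_S .$$ Here the chain order and the right weak order are defined as follows. For a standard Young tableau $T$ with $n$ boxes and $1\le i<j\le n$ let $\pi_{i,j}(T)$ be the tableau obtained from $T$ by removing the entries $1,\dots,i-1$ and $j+1,\dots,n$ by jeu de taquin, and let $D_{\langle i,j\rangle}(T)$ be its shape, written as the partition of $j-i+1$ given by the column lengths. Put $T\overset{C}{\le}S$ if $D_{\langle i,j\rangle}(T)\le D_{\langle i,j\rangle}(S)$ in the dominance order for all $1\le i<j\le n$, where $\mu\le\lambda$ in the dominance order means $\sum_{m\le k}\mu_m\le\sum_{m\le k}\lambda_m$ for all $k$; and $T\overset{C}{<}S$ if moreover $T\ne S$. For permutations $w,y$ of $1,\dots,n$ in word form put $w\overset{D}{\le}y$ if, for all $1\le i<j\le n$, whenever $j$ stands before $i$ in $w$, $j$ stands before $i$ in $y$; and $w\overset{D}{<}y$ if moreover $w\ne y$. The word $w_T=[a_n,a_{n-1},\dots,a_1]$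 is the following element of the Robinson–Schensted cell of $T$. Put $T_{(n)}=T$. For $i=n,n-1,\dots,1$ let $z_i$ be the largest entry of $T_{(i)}$; let $T_{(i-1)}$ be the tableau obtained from $T_{(i)}$ by deleting the corner with entry $z_i$ by inverse (column) insertion, and let $a_i$ be the entry pushed out: if $z_i$ is in the first column, it is just taken away and $a_i=z_i$; if $z_i$ is in the second column, it is taken away there, it replaces the largest entry of the first column that is smaller than $z_i$, and $a_i$ is that replaced entry. -/

import Mathlib

/-- An array of positive integers, given by the list of its columns from left to right; each column
is listed from top to bottom. -/
abbrev ColArray := List (List ℕ)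

namespace ColArray

/-- The content of the box in row `r` and column `c` (both counted from `0`), if there is such a
box. -/
def entry? (T : ColArray) (r c : ℕ) : Option ℕ := (T[c]?).bind fun C => C[r]?

/-- Young tableaux: no column is empty, columns increase from top to bottom, and every box outside
the first column has a left neighbour with a smaller content. The last condition says both that the
column lengths decrease weakly and that the rows increase from left to right. -/
def IsTableau (T : ColArray) : Prop :=
  (∀ C ∈ T, C ≠ [] ∧ C.Pairwise (· < ·)) ∧
  ∀ r c y, T.entry? r (c + 1) = some y → ∃ x, T.entry? r c = some x ∧ x < y

/-- Standard Young tableaux: Young tableaux in which each of `1, …, n` occurs exactly once and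
nothing else occurs. -/
def IsStandard (n : ℕ) (T : ColArray) : Prop :=
  T.IsTableau ∧ T.flatten.Perm (List.range' 1 n)

/-- The shape of an array: the list of its column lengths. -/
def shape (T : ColArray) : List ℕ := T.map List.length

/-- Omit the columns that have become empty. -/
def dropEmpty (T : ColArray) : ColArray := T.filter fun C => !C.isEmpty

/-- The index of the column in which `x` stands. -/
def colIdx (T : ColArray) (x : ℕ) : ℕ := T.findIdx fun C => C.contains x

/-- The index of the row in which `x` stands. -/
def rowIdx (T : ColArray) (x : ℕ) : ℕ := (T.getD (T.colIdx x) []).idxOf x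

/-- Put `x` into the box in row `r` and column `c`. -/
def setEntry (T : ColArray) (r c x : ℕ) : ColArray := T.modify c fun C => C.set r x

/-- The sliding part of jeu de taquin for a hole in row `r` and column `c`: the smaller of the right
and the lower neighbour slides into the hole, and so on, until the hole has neither of these
neighbours; then its box is deleted. The first argument bounds the number of rounds. -/
def slide : ℕ → ColArray → ℕ → ℕ → ColArray
  | 0, T, _, _ => T
  | k + 1, T, r, c =>
    match T.entry? r (c + 1), T.entry? (r + 1) c with
    | none, none => T.modify c fun C => C.eraseIdx r
    | some x, none => slide k (T.setEntry r c x) r (c + 1)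
    | none, some y => slide k (T.setEntry r c y) (r + 1) c
    | some x, some y =>
      if x < y then slide k (T.setEntry r c x) r (c + 1)
      else slide k (T.setEntry r c y) (r + 1) c

/-- Removal of the entry `x` by jeu de taquin. The hole visits every box at most once, so the number
of boxes is a sufficient bound for the number of rounds. -/
def remove (T : ColArray) (x : ℕ) : ColArray :=
  (slide T.flatten.length T (T.rowIdx x) (T.colIdx x)).dropEmpty

/-- The projection `π_{i,j}`: remove `n, n - 1, …, j + 1` and then `1, 2, …, i - 1` by jeu de
taquin. -/
def proj (n i j : ℕ) (T : ColArray) : ColArray :=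
  ((List.range' (j + 1) (n - j)).reverse ++ List.range' 1 (i - 1)).foldl remove T

/-- The dominance order `l ≤ m` on partitions of the same number, given by their lists of parts:
for each `k`, the sum of the first `k` parts of `l` is at most the one for `m`. -/
def DominanceLE (l m : List ℕ) : Prop := ∀ k, (l.take k).sum ≤ (m.take k).sum

/-- The chain order on standard tableaux with `n` boxes. -/
def ChainLE (n : ℕ) (T S : ColArray) : Prop :=
  ∀ i j, 1 ≤ i → i < j → j ≤ n → DominanceLE (T.proj n i j).shape (S.proj n i j).shape

/-- The strict chain order. -/
def ChainLT (n : ℕ) (T S : ColArray) : Prop := ChainLE n T S ∧ T ≠ S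

/-- The largest element of a list of natural numbers (`0` for the empty list). -/
def largest (C : List ℕ) : ℕ := C.foldr max 0

/-- Pushing `j` into a column from the right: `j` replaces the largest entry that is smaller than
`j`. The result is the new column together with the replaced entry. -/
def pushCol (C : List ℕ) (j : ℕ) : List ℕ × ℕ :=
  let a := largest (C.filter fun x => x < j)
  (C.replace a j, a)

/-- Pushing `j` left through an array: push `j` into the last column, push the entry replaced there
into the column before it, and so on. The result is the new array together with the entry that
leaves the first column; if there is no column, this is `j` itself. -/
def pushLeft : ColArray → ℕ → ColArray × ℕ
  | [], j => ([], j)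
  | C :: Cs, j =>
    let p := pushLeft Cs j
    let q := pushCol C p.2
    (q.1 :: p.1, q.2)

/-- Deletion of the corner with entry `z`, the inverse step of Robinson–Schensted insertion: take
the box of `z` away and push `z` left through the columns before its own. The result is the new
tableau together with the entry that is pushed out. -/
def deleteCorner (T : ColArray) (z : ℕ) : ColArray × ℕ :=
  let k := T.colIdx z
  let p := pushLeft (T.take k) z
  (dropEmpty (p.1 ++ (T.getD k []).erase z :: T.drop (k + 1)), p.2)

/-- The entries pushed out, in this order, when the corner with the largest entry is deleted `m`
times. -/
def deletionWord : ℕ → ColArray → List ℕ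
  | 0, _ => []
  | m + 1, T =>
    let p := T.deleteCorner (largest T.flatten)
    p.2 :: deletionWord m p.1

/-- The canonical representative `w_T = [a_n, …, a_1]` of the Robinson–Schensted cell of `T`. -/
def canonicalWord (T : ColArray) : List ℕ := deletionWord T.flatten.length T

end ColArray

/-- Permutations of `1, …, n` in word form. -/
def IsPermWord (n : ℕ) (w : List ℕ) : Prop := w.Perm (List.range' 1 n)

/-- The right weak order on the permutations of `1, …, n` in word form: whenever `i < j` and `j`
stands before `i` in `w`, then `j` stands before `i` in `y`. -/
def WeakLE (n : ℕ) (w y : List ℕ) : Prop :=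
  IsPermWord n w ∧ IsPermWord n y ∧
  ∀ i j, 1 ≤ i → i < j → j ≤ n → w.idxOf j < w.idxOf i → y.idxOf j < y.idxOf i

/-- The strict right weak order. -/
def WeakLT (n : ℕ) (w y : List ℕ) : Prop := WeakLE n w y ∧ w ≠ y

/-! A standard tableau with columns `A`, `B` is a ballot path `h = countLE A - countLE B`: up at the
entries of `A`, down at those of `B`. Each down step is matched with an earlier up step by an arc
(`IsArc`). Both orders turn out to be the same condition `Agree`: steps joined by an arc of the path
of `S` keep their directions in the path of `T`.

Chain order. With `x = i - 1`, the two column lengths of `π_{i,j}(T)` differ by the tree distance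
`pathDist h x j`. This is proved for all initial parts of the window at once (`IsWindow`), since a
slide that removes the first entry changes the difference by the same rule as moving `x` one step
along the path (`height_refill`, `pathDist_eq_succ`). With at most two columns, dominance compares
these distances. An arc has distance `0`, so smaller distances for `T` force `Agree`; conversely,
`Agree` makes every arc of `S` an arc of `T`, and more arcs mean smaller distances.

Weak order. `popWord_idxOf_lt_iff` reads off the path which pairs are not inverted in the canonical
word (`NonInv`). Inclusion of these sets of pairs is again equivalent to `Agree` (`nonInv_of_agree`,
`agree_of_nonInv`). Finally `Agree` is antisymmetric, which handles strictness. -/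

/-! ### Arcs and tree distance of paths with unit steps -/

/-- The path `h` has steps `1` and `-1` up to time `n`. -/
def UnitSteps (n : ℕ) (h : ℕ → ℤ) : Prop := ∀ k < n, h (k + 1) = h k + 1 ∨ h (k + 1) = h k - 1

/-- The up step after `x` is matched with the down step before `y`: at `y` the path `h` returns for
the first time to its level at `x`. -/
def IsArc (h : ℕ → ℤ) (x y : ℕ) : Prop := x < y ∧ h y = h x ∧ ∀ z, x < z → z < y → h x < h z

/-- The distance of `x` and `z` in the tree of the path `h`. -/
noncomputable def pathDist (h : ℕ → ℤ) (x z : ℕ) : ℤ := h x + h z - 2 * sInf (h '' Set.Icc x z)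

/-- Unit steps cannot jump over a level, so the first time after `x` that is not above `h x` is
exactly at `h x`. -/
theorem UnitSteps.exists_isArc_right {n : ℕ} {h : ℕ → ℤ} (hs : UnitSteps n h) {x y : ℕ}
    (hxy : x < y) (hy : y ≤ n) (hx : h (x + 1) = h x + 1) (hle : h y ≤ h x) :
    ∃ k ≤ y, IsArc h x k := by
  classical
  have hex : ∃ k, x < k ∧ h k ≤ h x := ⟨y, hxy, hle⟩
  obtain ⟨h1, h2⟩ := Nat.find_spec hex
  have hmin : ∀ m, m < Nat.find hex → ¬ (x < m ∧ h m ≤ h x) := fun m hm => Nat.find_min hex hm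
  have hky : Nat.find hex ≤ y := Nat.find_min' hex ⟨hxy, hle⟩
  generalize Nat.find hex = k at *
  obtain ⟨k, rfl⟩ : ∃ j, k = j + 1 := ⟨k - 1, by omega⟩
  have hxk : x ≠ k := by rintro rfl; omega
  have h3 := hmin k (by omega)
  have h4 := hs k (by omega)
  refine ⟨k + 1, hky, h1, by omega, fun z hz hz' => ?_⟩
  have := hmin z hz'
  omega

theorem UnitSteps.exists_isArc_left {n : ℕ} {h : ℕ → ℤ} (hs : UnitSteps n h) {x y : ℕ}
    (hxy : x ≤ y) (hy : y < n) (hd : h (y + 1) = h y - 1) (hle : h x ≤ h (y + 1)) :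
    ∃ k, x ≤ k ∧ IsArc h k (y + 1) := by
  classical
  have hspec := Nat.findGreatest_spec (P := fun k => h k ≤ h (y + 1)) hxy hle
  have hge := Nat.le_findGreatest (P := fun k => h k ≤ h (y + 1)) hxy hle
  have hley := Nat.findGreatest_le (P := fun k => h k ≤ h (y + 1)) y
  have hmax : ∀ m, Nat.findGreatest (fun k => h k ≤ h (y + 1)) y < m → m ≤ y →
      ¬ (h m ≤ h (y + 1)) := fun m h1 h2 => Nat.findGreatest_is_greatest h1 h2
  generalize Nat.findGreatest (fun k => h k ≤ h (y + 1)) y = k at *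
  have hky : k ≠ y := by rintro rfl; omega
  have h3 := hmax (k + 1) (by omega) (by omega)
  have h4 := hs k (by omega)
  refine ⟨k, hge, by omega, by omega, fun z hz hz' => ?_⟩
  have := hmax z hz (by omega)
  omega

theorem isLeast_sInf_path (h : ℕ → ℤ) {x z : ℕ} (hxz : x ≤ z) :
    IsLeast (h '' Set.Icc x z) (sInf (h '' Set.Icc x z)) := by
  have hf : (h '' Set.Icc x z).Finite := (Set.finite_Icc x z).image h
  have hne : (h '' Set.Icc x z).Nonempty := (Set.nonempty_Icc.2 hxz).image h
  exact ⟨hne.csInf_mem hf, fun a ha => csInf_le hf.bddBelow ha⟩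

theorem exists_pathDist_eq (h : ℕ → ℤ) {x z : ℕ} (hxz : x ≤ z) :
    ∃ w, x ≤ w ∧ w ≤ z ∧ (∀ v, x ≤ v → v ≤ z → h w ≤ h v) ∧
      pathDist h x z = h x + h z - 2 * h w := by
  obtain ⟨⟨w, ⟨h1, h2⟩, h3⟩, hl⟩ := isLeast_sInf_path h hxz
  refine ⟨w, h1, h2, fun v hv hv' => ?_, ?_⟩
  · rw [h3]; exact hl ⟨v, ⟨hv, hv'⟩, rfl⟩
  · rw [h3, pathDist]

theorem pathDist_self (h : ℕ → ℤ) (x : ℕ) : pathDist h x x = 0 := by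
  obtain ⟨w, h1, h2, -, h4⟩ := exists_pathDist_eq h (le_refl x)
  obtain rfl : w = x := by omega
  omega

theorem pathDist_nonneg (h : ℕ → ℤ) {x z : ℕ} (hxz : x ≤ z) : 0 ≤ pathDist h x z := by
  obtain ⟨w, h1, h2, h3, h4⟩ := exists_pathDist_eq h hxz
  have := h3 x le_rfl hxz
  have := h3 z hxz le_rfl
  omega

theorem pathDist_eq_zero_iff (h : ℕ → ℤ) {x z : ℕ} (hxz : x ≤ z) :
    pathDist h x z = 0 ↔ h z = h x ∧ ∀ v, x ≤ v → v ≤ z → h x ≤ h v := by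
  obtain ⟨w, h1, h2, h3, h4⟩ := exists_pathDist_eq h hxz
  have h5 := h3 x le_rfl hxz
  have h6 := h3 z hxz le_rfl
  constructor
  · intro h0
    refine ⟨by omega, fun v hv hv' => ?_⟩
    have := h3 v hv hv'
    omega
  · rintro ⟨h7, h8⟩
    have := h8 w h1 h2
    omega

-- If an arc from `x` closes by time `z`, then `h x` is one lower than `h (x + 1)` while the minimum
-- is unchanged. Otherwise an up step at `x` makes `h x` the new minimum, and a down step leaves the
-- minimum alone but starts one higher; both add `1`.
open Classical in
theorem UnitSteps.pathDist_eq_succ {n : ℕ} {h : ℕ → ℤ} (hs : UnitSteps n h) {x z : ℕ}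
    (hxz : x < z) (hz : z ≤ n) :
    pathDist h x z = pathDist h (x + 1) z + if ∃ k ≤ z, IsArc h x k then -1 else 1 := by
  obtain ⟨w, h1, h2, h3, h4⟩ := exists_pathDist_eq h hxz.le
  obtain ⟨w', h1', h2', h3', h4'⟩ := exists_pathDist_eq h (x := x + 1) (z := z) hxz
  have hst := hs x (by omega)
  have ha := h3 w' (by omega) h2'
  have hb := h3 x le_rfl hxz.le
  have hc : h w = h x ∨ h w' ≤ h w := by
    rcases Nat.eq_or_lt_of_le h1 with rfl | hlt
    · exact Or.inl rfl
    · exact Or.inr (h3' w hlt h2)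
  have hd := h3' (x + 1) le_rfl hxz
  split_ifs with hk
  · obtain ⟨k, hkz, hxk, hk1, hk2⟩ := hk
    have hne : k ≠ x + 1 := by rintro rfl; omega
    have he := hk2 (x + 1) (by omega) (by omega)
    have hf := h3' k (by omega) hkz
    omega
  · rcases hst with hst | hst
    · have : h x < h w' := by
        by_contra hcon
        obtain ⟨k, hk1, hk2⟩ := hs.exists_isArc_right (x := x) (y := w') (by omega) (by omega) hst
          (by omega)
        exact hk ⟨k, by omega, hk2⟩
      omega
    · omega

/-- Shrinking the window from the left down to `z`, each starting point contributes `-1` or `1`, and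
`-1` exactly when its arc closes by `z`. -/
theorem UnitSteps.pathDist_le {n : ℕ} {g h : ℕ → ℤ} (hg : UnitSteps n g) (hh : UnitSteps n h)
    (harc : ∀ x y, y ≤ n → IsArc h x y → IsArc g x y) {x z : ℕ} (hxz : x ≤ z) (hz : z ≤ n) :
    pathDist g x z ≤ pathDist h x z := by
  induction hd : z - x generalizing x with
  | zero =>
    obtain rfl : x = z := by omega
    simp [pathDist_self]
  | succ d ih =>
    have := ih (x := x + 1) (by omega) (by omega)
    rw [hg.pathDist_eq_succ (by omega) hz, hh.pathDist_eq_succ (by omega) hz]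
    have himp : (∃ k ≤ z, IsArc h x k) → ∃ k ≤ z, IsArc g x k :=
      fun ⟨k, hk, hk'⟩ => ⟨k, hk, harc x k (hk.trans hz) hk'⟩
    split_ifs with h1 h2 <;> first | omega | exact absurd (himp ‹_›) ‹_›

/-! ### Ballot paths: agreement on arcs, distances and noninversions -/

/-- `p` and `q` count the up steps and the down steps of a path of length `n` that stays weakly
above its starting level. -/
structure IsBallot (n : ℕ) (p q : ℕ → ℤ) : Prop where
  left_zero : p 0 = 0
  right_zero : q 0 = 0
  step : ∀ k < n, p (k + 1) = p k + 1 ∧ q (k + 1) = q k ∨ p (k + 1) = p k ∧ q (k + 1) = q k + 1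
  le : ∀ k ≤ n, q k ≤ p k

/-- The up step number `i + 1` and the down step number `j + 1` do not form an inversion of the
canonical word. -/
def NonInv (n : ℕ) (p q : ℕ → ℤ) (i j : ℕ) : Prop :=
  i < j ∧ j < n ∧ p (i + 1) = p i + 1 ∧ q (j + 1) = q j + 1 ∧
    ∃ b, j < b ∧ b ≤ n ∧ p b - p i ≤ q b - q j

/-- Steps that are matched in the second path have the same direction in the first one. -/
def Agree (n : ℕ) (p q p' q' : ℕ → ℤ) : Prop :=
  ∀ x y, y < n → IsArc (p' - q') x (y + 1) → p (x + 1) = p x + 1 ∧ q (y + 1) = q y + 1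

namespace IsBallot

variable {n : ℕ} {p q p' q' : ℕ → ℤ}

theorem unitSteps (hb : IsBallot n p q) : UnitSteps n (p - q) := by
  intro k hk
  have := hb.step k hk
  simp only [Pi.sub_apply]
  omega

theorem mono_left (hb : IsBallot n p q) {x y : ℕ} (hxy : x ≤ y) (hy : y ≤ n) : p x ≤ p y := by
  induction y, hxy using Nat.le_induction with
  | base => exact le_rfl
  | succ y _ ih => have := ih (by omega); have := hb.step y (by omega); omega

theorem mono_right (hb : IsBallot n p q) {x y : ℕ} (hxy : x ≤ y) (hy : y ≤ n) : q x ≤ q y := by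
  induction y, hxy using Nat.le_induction with
  | base => exact le_rfl
  | succ y _ ih => have := ih (by omega); have := hb.step y (by omega); omega

theorem exists_isArc_of_down (hb : IsBallot n p q) {y : ℕ} (hy : y < n)
    (hd : q (y + 1) = q y + 1) : ∃ x, IsArc (p - q) x (y + 1) := by
  have h1 := hb.step y hy
  have h2 := hb.le (y + 1) hy
  have h3 := hb.left_zero
  have h4 := hb.right_zero
  obtain ⟨k, -, hk⟩ := hb.unitSteps.exists_isArc_left (Nat.zero_le y) hy
    (by simp only [Pi.sub_apply]; omega) (by simp only [Pi.sub_apply]; omega)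
  exact ⟨k, hk⟩

/-- An arc of the second path has distance `0`, hence so has the same interval in the first path.
That path then stays weakly above its common end level, so it starts with an up step and ends with a
down step. -/
theorem agree_of_pathDist_le (hb : IsBallot n p q)
    (hd : ∀ x z, x + 1 < z → z ≤ n → pathDist (p - q) x z ≤ pathDist (p' - q') x z)
    (hb' : IsBallot n p' q') : Agree n p q p' q' := by
  intro x y hy harc
  obtain ⟨h1, h2, h3⟩ := harc
  -- An arc has length at least `2`, so the missing distance bound for windows of length `1` does no
  -- harm.
  have hne : x ≠ y := by
    rintro rfl
    have := hb'.step x hy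
    simp only [Pi.sub_apply] at h2
    omega
  have h0 : pathDist (p' - q') x (y + 1) = 0 := by
    rw [pathDist_eq_zero_iff _ h1.le]
    refine ⟨h2, fun v hv hv' => ?_⟩
    rcases Nat.eq_or_lt_of_le hv with rfl | hv
    · exact le_rfl
    rcases Nat.eq_or_lt_of_le hv' with rfl | hv'
    · exact h2.ge
    · exact (h3 v hv hv').le
  have h5 : pathDist (p - q) x (y + 1) = 0 :=
    le_antisymm (h0 ▸ hd x (y + 1) (by omega) hy) (pathDist_nonneg _ h1.le)
  rw [pathDist_eq_zero_iff _ h1.le] at h5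
  obtain ⟨h6, h7⟩ := h5
  have h8 := h7 (x + 1) (by omega) (by omega)
  have h9 := h7 y (by omega) (by omega)
  have := hb.step x (by omega)
  have := hb.step y hy
  simp only [Pi.sub_apply] at h6 h8 h9
  omega

/-- Under an arc of the second path every step belongs to an arc: an up step returns by time `y`,
and a down step is matched because the path is ballot. Hence the two paths run parallel from `x` to
`y`. -/
theorem isArc_of_agree (hb : IsBallot n p q) (hb' : IsBallot n p' q') (ha : Agree n p q p' q')
    {x y : ℕ} (hy : y ≤ n) (harc : IsArc (p' - q') x y) : IsArc (p - q) x y := by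
  have h2 := harc.2.1
  have h3 := harc.2.2
  have hge : ∀ z, x ≤ z → z ≤ y → (p' - q') x ≤ (p' - q') z := fun v hv hv' => by
    rcases Nat.eq_or_lt_of_le hv with rfl | hv
    · exact le_rfl
    rcases Nat.eq_or_lt_of_le hv' with rfl | hv'
    · exact h2.ge
    · exact (h3 v hv hv').le
  have key : ∀ z, x ≤ z → z ≤ y → (p - q) z - (p - q) x = (p' - q') z - (p' - q') x := by
    intro z hz
    induction z, hz using Nat.le_induction with
    | base => simp
    | succ z hz ih =>
      intro hzy
      have ih := ih (by omega)
      have hs := hb.step z (by omega)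
      have hs' := hb'.step z (by omega)
      simp only [Pi.sub_apply] at ih ⊢
      rcases hs' with hs' | hs'
      · have h4 := hge z hz (by omega)
        obtain ⟨k, hk1, hk2⟩ := hb'.unitSteps.exists_isArc_right (x := z) (y := y) (by omega) hy
          (by simp only [Pi.sub_apply]; omega) (by omega)
        obtain ⟨k, rfl⟩ : ∃ j, k = j + 1 := ⟨k - 1, by have := hk2.1; omega⟩
        have := (ha z k (by omega) hk2).1
        omega
      · obtain ⟨k, hk⟩ := hb'.exists_isArc_of_down (by omega) hs'.2
        have := (ha k z (by omega) hk).2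
        omega
  refine ⟨harc.1, ?_, fun z hz hz' => ?_⟩
  · have := key y harc.1.le le_rfl
    omega
  · have := key z hz.le hz'.le
    have := h3 z hz hz'
    omega

/-- For the least witness `b`, the second path is nowhere on `[i, b)` below its level at `b`. So all
its up steps there are matched, as are all down steps; the paths run parallel on `[i, b]`, and `b`
is a witness for the first path too. -/
theorem nonInv_of_agree (hb : IsBallot n p q) (hb' : IsBallot n p' q') (ha : Agree n p q p' q')
    {i j : ℕ} (hN : NonInv n p' q' i j) : NonInv n p q i j := by
  classical
  obtain ⟨hij, hjn, hi, hj, hex⟩ := hN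
  obtain ⟨hjb, hbn, hle⟩ := Nat.find_spec hex
  have hmin : ∀ m, m < Nat.find hex → ¬ (j < m ∧ m ≤ n ∧ p' m - p' i ≤ q' m - q' j) :=
    fun m hm => Nat.find_min hex hm
  generalize Nat.find hex = b at *
  have hup : ∀ z, i ≤ z → z < b → p' (z + 1) = p' z + 1 → p (z + 1) = p z + 1 := by
    intro z hz hzb hup
    have hs := hb'.step z (by omega)
    have hlow : (p' - q') b ≤ (p' - q') z := by
      simp only [Pi.sub_apply]
      rcases le_or_gt z j with hzj | hzj
      · have := hb'.mono_left hz (by omega)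
        have := hb'.mono_right hzj (by omega)
        omega
      · have := hmin z hzb
        omega
    obtain ⟨k, hk1, hk2⟩ := hb'.unitSteps.exists_isArc_right (x := z) (y := b) hzb hbn
      (by simp only [Pi.sub_apply]; omega) hlow
    obtain ⟨k, rfl⟩ : ∃ j, k = j + 1 := ⟨k - 1, by have := hk2.1; omega⟩
    exact (ha z k (by omega) hk2).1
  have hdown : ∀ z < n, q' (z + 1) = q' z + 1 → q (z + 1) = q z + 1 := by
    intro z hz hd
    obtain ⟨k, hk⟩ := hb'.exists_isArc_of_down hz hd
    exact (ha k z hz hk).2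
  have key : ∀ z, i ≤ z → z ≤ b → p z - p i = p' z - p' i ∧ q z - q i = q' z - q' i := by
    intro z hz
    induction z, hz using Nat.le_induction with
    | base => simp
    | succ z hz ih =>
      intro hzb
      have ih := ih (by omega)
      have hs := hb.step z (by omega)
      have hs' := hb'.step z (by omega)
      have h1 := hup z hz (by omega)
      have h2 := hdown z (by omega)
      omega
  have h1 := key b (by omega) le_rfl
  have h2 := key j hij.le hjb.le
  exact ⟨hij, hjn, hup i le_rfl (by omega) hi, hdown j hjn hj, b, hjb, hbn, by omega⟩

/-- For an arc from `x` to `y + 1`, two noninversions with witness `y + 1` suffice: `x` with the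
first down step after it shows that `x` is an up step, and the last up step before `y` together with
`y` shows that `y` is a down step. -/
theorem agree_of_nonInv (hb' : IsBallot n p' q')
    (hN : ∀ i j, NonInv n p' q' i j → NonInv n p q i j) : Agree n p q p' q' := by
  classical
  intro x y hy harc
  obtain ⟨h1, h2, h3⟩ := harc
  have hsx := hb'.step x (by omega)
  have hsy := hb'.step y hy
  simp only [Pi.sub_apply] at h2 h3
  have hne : x ≠ y := by
    rintro rfl
    omega
  have hx1 := h3 (x + 1) (by omega) (by omega)
  have hy1 := h3 y (by omega) (by omega)
  constructor
  · have hex : ∃ j, x < j ∧ q' (j + 1) = q' j + 1 := ⟨y, by omega, by omega⟩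
    obtain ⟨hxj, hj⟩ := Nat.find_spec hex
    have hmin : ∀ m, m < Nat.find hex → ¬ (x < m ∧ q' (m + 1) = q' m + 1) :=
      fun m hm => Nat.find_min hex hm
    have hjy : Nat.find hex ≤ y := Nat.find_min' hex ⟨by omega, by omega⟩
    generalize Nat.find hex = j at *
    have hq : ∀ z, x + 1 ≤ z → z ≤ j → q' z = q' x := by
      intro z hz
      induction z, hz using Nat.le_induction with
      | base => intro; omega
      | succ z hz ih =>
        intro hzj
        have := ih (by omega)
        have := hmin z (by omega)
        have := hb'.step z (by omega)
        omega
    have := hq j hxj le_rfl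
    exact (hN x j ⟨hxj, by omega, by omega, hj, y + 1, by omega, by omega, by omega⟩).2.2.1
  · have hspec := Nat.findGreatest_spec (P := fun k => k < y ∧ p' (k + 1) = p' k + 1)
      (m := x) (n := y) (by omega) ⟨by omega, by omega⟩
    have hmax : ∀ m, Nat.findGreatest (fun k => k < y ∧ p' (k + 1) = p' k + 1) y < m → m ≤ y →
        ¬ (m < y ∧ p' (m + 1) = p' m + 1) := fun m h1 h2 => Nat.findGreatest_is_greatest h1 h2
    generalize Nat.findGreatest (fun k => k < y ∧ p' (k + 1) = p' k + 1) y = i at *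
    have hp : ∀ z, i + 1 ≤ z → z ≤ y → p' z = p' i + 1 := by
      intro z hz
      induction z, hz using Nat.le_induction with
      | base => intro; omega
      | succ z hz ih =>
        intro hzj
        have := ih (by omega)
        have := hmax z (by omega) (by omega)
        have := hb'.step z (by omega)
        omega
    have := hp y hspec.1 le_rfl
    exact (hN i y ⟨hspec.1, hy, hspec.2, by omega, y + 1, by omega, by omega, by omega⟩).2.2.2.1

end IsBallot

/-! ### Jeu de taquin on two columns -/

namespace ColArray

/-- The number of elements of `A` that are at most `z`. -/
def countLE (A : List ℕ) (z : ℕ) : ℤ := A.countP fun x => x ≤ z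

/-- The number of elements of `A` that are at most `z` minus that of `B`. -/
def height (A B : List ℕ) (z : ℕ) : ℤ := countLE A z - countLE B z

theorem countLE_nil (z : ℕ) : countLE [] z = 0 := rfl

theorem countLE_cons (a : ℕ) (A : List ℕ) (z : ℕ) :
    countLE (a :: A) z = countLE A z + if a ≤ z then 1 else 0 := by
  simp only [countLE, List.countP_cons, decide_eq_true_eq]
  split_ifs <;> simp

theorem countLE_append (A B : List ℕ) (z : ℕ) :
    countLE (A ++ B) z = countLE A z + countLE B z := by
  simp [countLE]

theorem countLE_perm {A B : List ℕ} (h : A.Perm B) (z : ℕ) : countLE A z = countLE B z := by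
  simp [countLE, h.countP_eq]

theorem countLE_nonneg (A : List ℕ) (z : ℕ) : 0 ≤ countLE A z := by simp [countLE]

theorem countLE_le_length (A : List ℕ) (z : ℕ) : countLE A z ≤ A.length := by
  simp only [countLE]
  exact_mod_cast List.countP_le_length

theorem countLE_mono (A : List ℕ) {y z : ℕ} (h : y ≤ z) : countLE A y ≤ countLE A z := by
  simp only [countLE]
  exact_mod_cast List.countP_mono_left fun x _ hx => by
    simp only [decide_eq_true_eq] at hx ⊢
    omega

theorem countLE_eq_zero {A : List ℕ} {z : ℕ} (h : ∀ x ∈ A, z < x) : countLE A z = 0 := by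
  simp only [countLE, Nat.cast_eq_zero, List.countP_eq_zero, decide_eq_true_eq]
  intro x hx
  have := h x hx
  omega

theorem countLE_eq_length {A : List ℕ} {z : ℕ} (h : ∀ x ∈ A, x ≤ z) :
    countLE A z = A.length := by
  simp only [countLE]
  exact_mod_cast List.countP_eq_length.2 fun x hx => by simpa using h x hx

theorem countLE_succ (A : List ℕ) (z : ℕ) :
    countLE A (z + 1) = countLE A z + A.count (z + 1) := by
  induction A with
  | nil => rfl
  | cons a A ih =>
    rw [countLE_cons, countLE_cons, ih, List.count_cons]
    simp only [beq_iff_eq]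
    split_ifs <;> push_cast <;> omega

/-- The two columns after a jeu de taquin slide through two adjacent columns: `A` stands below the
hole, and `B` stands in the right column, from the row of the hole downwards. -/
def refill : List ℕ → List ℕ → List ℕ × List ℕ
  | A, [] => (A, [])
  | [], b :: B => ([b], B)
  | a :: A, b :: B =>
    if b < a then (b :: a :: A, B) else (a :: (refill A B).1, b :: (refill A B).2)

theorem refill_nil (A : List ℕ) : refill A [] = (A, []) := by cases A <;> rfl

theorem refill_perm (A B : List ℕ) : ((refill A B).1 ++ (refill A B).2).Perm (A ++ B) := by
  fun_induction refill A B with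
  | case1 A => simp
  | case2 b B => simp
  | case3 a A b B h =>
    exact (List.perm_middle (l₁ := a :: A)).symm
  | case4 a A b B h ih =>
    simp only [List.cons_append, List.perm_cons]
    exact List.perm_middle.trans ((ih.cons b).trans List.perm_middle.symm)

theorem refill_fst_mem {A B : List ℕ} {x : ℕ} (h : x ∈ (refill A B).1) : x ∈ A ∨ x ∈ B := by
  have := (refill_perm A B).mem_iff (a := x)
  simp only [List.mem_append] at this
  tauto

theorem refill_snd_sublist (A B : List ℕ) : (refill A B).2.Sublist B := by
  fun_induction refill A B with
  | case1 A => simp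
  | case2 b B => simp
  | case3 a A b B h => simp
  | case4 a A b B h ih => exact ih.cons_cons b

theorem refill_fst_pairwise {A B : List ℕ} (hA : A.Pairwise (· < ·)) (hB : B.Pairwise (· < ·)) :
    (refill A B).1.Pairwise (· < ·) := by
  fun_induction refill A B with
  | case1 A => exact hA
  | case2 b B => simp
  | case3 a A b B h =>
    refine List.pairwise_cons.2 ⟨fun x hx => ?_, hA⟩
    rcases List.mem_cons.1 hx with rfl | hx
    · exact h
    · exact h.trans ((List.pairwise_cons.1 hA).1 x hx)
  | case4 a A b B h ih =>
    rw [List.pairwise_cons] at hA hB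
    refine List.pairwise_cons.2 ⟨fun x hx => ?_, ih hA.2 hB.2⟩
    rcases refill_fst_mem hx with hx | hx
    · exact hA.1 x hx
    · have := hB.1 x hx
      omega

-- Exactly one entry changes column, which raises the height by `2` from that entry on. It is the
-- first one at which the entries of `B` outnumber those of `A`, since up to there the hole keeps
-- falling in the left column.
open Classical in
theorem height_refill {A B : List ℕ} (hA : A.Pairwise (· < ·)) (hB : B.Pairwise (· < ·)) (z : ℕ) :
    height (refill A B).1 (refill A B).2 z =
      height A B z + if ∃ w ≤ z, height A B w = -1 then 2 else 0 := by
  have aux : ∀ (A B : List ℕ) (b : ℕ), (∀ x ∈ A, b < x) → (∀ x ∈ B, b < x) →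
      ((∃ w ≤ z, height A (b :: B) w = -1) ↔ b ≤ z) := by
    intro A B b hA hB
    constructor
    · rintro ⟨w, hw, h⟩
      by_contra hlt
      rw [height, countLE_cons, countLE_eq_zero fun x hx => by have := hA x hx; omega,
        countLE_eq_zero fun x hx => by have := hB x hx; omega, if_neg (by omega)] at h
      omega
    · intro hz
      refine ⟨b, hz, ?_⟩
      rw [height, countLE_cons, countLE_eq_zero hA, countLE_eq_zero hB]
      simp
  fun_induction refill A B with
  | case1 A =>
    rw [if_neg, add_zero]
    rintro ⟨w, -, hw⟩
    have := countLE_nonneg A w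
    simp only [height, countLE_nil] at hw
    omega
  | case2 b B =>
    rw [List.pairwise_cons] at hB
    simp only [aux [] B b (by simp) hB.1]
    simp only [height, countLE_cons, countLE_nil]
    split_ifs <;> omega
  | case3 a A b B h =>
    rw [List.pairwise_cons] at hB
    have hb : ∀ x ∈ a :: A, b < x := fun x hx => by
      rcases List.mem_cons.1 hx with rfl | hx
      · exact h
      · exact h.trans ((List.pairwise_cons.1 hA).1 x hx)
    simp only [aux (a :: A) B b hb hB.1]
    simp only [height, countLE_cons]
    split_ifs <;> omega
  | case4 a A b B h ih =>
    rw [List.pairwise_cons] at hA hB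
    -- From `b` on, the two heads cancel; before `b`, neither height can be negative because `B`
    -- does not contribute yet.
    have hiff : (∃ w ≤ z, height (a :: A) (b :: B) w = -1) ↔ ∃ w ≤ z, height A B w = -1 := by
      refine exists_congr fun w => and_congr_right fun _ => ?_
      simp only [height, countLE_cons]
      rcases le_or_gt b w with hb | hb
      · rw [if_pos hb, if_pos (by omega)]
        constructor <;> intro <;> omega
      · have := countLE_nonneg A w
        rw [if_neg (show ¬ b ≤ w by omega),
          countLE_eq_zero (A := B) fun x hx => by have := hB.1 x hx; omega]
        split_ifs <;> constructor <;> intro <;> omega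
    have ih := ih hA.2 hB.2
    simp only [hiff]
    simp only [height, countLE_cons] at ih ⊢
    omega

theorem modify_append_cons {α : Type*} (Ts Us : List α) (x : α) (f : α → α) :
    (Ts ++ x :: Us).modify Ts.length f = Ts ++ f x :: Us := by
  induction Ts with
  | nil => rfl
  | cons t Ts ih => simp [List.modify_succ_cons, ih]

/-- Without a right neighbour in the row of the hole there is none further down either, so the hole
falls to the foot of its column. -/
theorem slide_down (C pre : List ℕ) (h k : ℕ) (Ts Us : ColArray) (hk : C.length < k)
    (hU : ∀ D ∈ Us.head?, D.length ≤ pre.length) :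
    slide k (Ts ++ (pre ++ h :: C) :: Us) pre.length Ts.length = Ts ++ (pre ++ C) :: Us := by
  induction C generalizing k pre h with
  | nil =>
    obtain ⟨k, rfl⟩ : ∃ j, k = j + 1 := ⟨k - 1, by simp at hk; omega⟩
    have h1 : entry? (Ts ++ (pre ++ [h]) :: Us) pre.length (Ts.length + 1) = none := by
      cases Us with
      | nil => simp [entry?]
      | cons D Us => simpa [entry?, List.getElem?_append_right] using hU
    have h2 : entry? (Ts ++ (pre ++ [h]) :: Us) (pre.length + 1) Ts.length = none := by
      simp [entry?]
    simp [slide, h1, h2, modify_append_cons, List.eraseIdx_append_of_length_le]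
  | cons c C ih =>
    obtain ⟨k, rfl⟩ : ∃ j, k = j + 1 := ⟨k - 1, by simp at hk; omega⟩
    have h1 : entry? (Ts ++ (pre ++ h :: c :: C) :: Us) pre.length (Ts.length + 1) = none := by
      cases Us with
      | nil => simp [entry?]
      | cons D Us => simpa [entry?, List.getElem?_append_right] using hU
    have h2 : entry? (Ts ++ (pre ++ h :: c :: C) :: Us) (pre.length + 1) Ts.length = some c := by
      simp [entry?]
    have := ih (pre ++ [c]) c k (by simpa using hk) fun D hD => by
      have := hU D hD
      simp
      omega
    simp only [List.append_assoc, List.cons_append, List.nil_append, List.length_append,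
      List.length_cons, List.length_nil, zero_add] at this
    simpa [slide, h1, h2, setEntry, modify_append_cons, List.set_append_right] using this

theorem slide_two (A B pre preB : List ℕ) (h k : ℕ) (hl : pre.length = preB.length)
    (hk : A.length + B.length < k) :
    slide k [pre ++ h :: A, preB ++ B] pre.length 0 =
      [pre ++ (refill A B).1, preB ++ (refill A B).2] := by
  fun_induction refill A B generalizing k pre preB h with
  | case1 A =>
    exact slide_down A pre h k [] [preB ++ []] (by simpa using hk) (by simp [hl])
  | case2 b B =>
    obtain ⟨k, rfl⟩ : ∃ j, k = j + 1 := ⟨k - 1, by omega⟩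
    have h1 : entry? [pre ++ [h], preB ++ b :: B] pre.length 1 = some b := by
      simp [entry?, hl]
    have h2 : entry? [pre ++ [h], preB ++ b :: B] (pre.length + 1) 0 = none := by
      simp [entry?]
    have := slide_down B preB b k [pre ++ [b]] [] (by simp at hk; omega) (by simp)
    simp only [slide, zero_add, h1, h2]
    simpa [setEntry, List.set_append_right, hl] using this
  | case3 a A b B hab =>
    obtain ⟨k, rfl⟩ : ∃ j, k = j + 1 := ⟨k - 1, by omega⟩
    have h1 : entry? [pre ++ h :: a :: A, preB ++ b :: B] pre.length 1 = some b := by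
      simp [entry?, hl]
    have h2 : entry? [pre ++ h :: a :: A, preB ++ b :: B] (pre.length + 1) 0 = some a := by
      simp [entry?]
    have := slide_down B preB b k [pre ++ b :: a :: A] [] (by simp at hk; omega) (by simp)
    simp only [slide, zero_add, h1, h2, if_pos hab]
    simpa [setEntry, List.set_append_right, hl] using this
  | case4 a A b B hab ih =>
    obtain ⟨k, rfl⟩ : ∃ j, k = j + 1 := ⟨k - 1, by omega⟩
    have h1 : entry? [pre ++ h :: a :: A, preB ++ b :: B] pre.length 1 = some b := by
      simp [entry?, hl]
    have h2 : entry? [pre ++ h :: a :: A, preB ++ b :: B] (pre.length + 1) 0 = some a := by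
      simp [entry?]
    have := ih (pre ++ [a]) (preB ++ [b]) a k (by simp [hl]) (by simp at hk; omega)
    simp only [slide, zero_add, h1, h2, if_neg hab]
    simpa [setEntry, List.set_append_right] using this

/-- The array with the columns `A` and `B`, of which empty ones are omitted. -/
def ofCols (A B : List ℕ) : ColArray := dropEmpty [A, B]

theorem ofCols_cons_nil (a : ℕ) (A : List ℕ) : ofCols (a :: A) [] = [a :: A] := rfl

theorem ofCols_cons_cons (a b : ℕ) (A B : List ℕ) :
    ofCols (a :: A) (b :: B) = [a :: A, b :: B] := rfl

theorem dropEmpty_singleton (A : List ℕ) : dropEmpty [A] = ofCols A [] := by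
  cases A <;> rfl

theorem length_flatten_ofCols (A B : List ℕ) :
    (ofCols A B).flatten.length = A.length + B.length := by
  cases A <;> cases B <;> simp [ofCols, dropEmpty, Nat.add_assoc, Nat.add_comm 1]

theorem ofCols_of_ne_nil {A B : List ℕ} (hA : A ≠ []) (hB : B ≠ []) : ofCols A B = [A, B] := by
  cases A <;> cases B <;> simp_all [ofCols, dropEmpty]

theorem ofCols_of_nil {A : List ℕ} (hA : A ≠ []) : ofCols A [] = [A] := by
  cases A <;> simp_all [ofCols, dropEmpty]

theorem remove_head (a : ℕ) (A B : List ℕ) :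
    (ofCols (a :: A) B).remove a = ofCols (refill A B).1 (refill A B).2 := by
  cases B with
  | nil =>
    have := slide_down A [] a (A.length + 1) [] [] (by simp) (by simp)
    simp only [List.nil_append, List.length_nil] at this
    simp [ofCols_cons_nil, remove, colIdx, rowIdx, List.findIdx_cons, this, dropEmpty_singleton,
      refill_nil]
  | cons b B =>
    have := slide_two A (b :: B) [] [] a (A.length + (B.length + 1) + 1) rfl
      (by simp only [List.length_cons]; omega)
    simp only [List.nil_append, List.length_nil] at this
    rw [ofCols_cons_cons]
    simp [remove, colIdx, rowIdx, List.findIdx_cons, this, ofCols]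

theorem remove_last_left {A B : List ℕ} {x : ℕ} (hx : x ∉ A) (hl : B.length ≤ A.length) :
    (ofCols (A ++ [x]) B).remove x = ofCols A B := by
  rcases eq_or_ne B [] with rfl | hB
  · have := slide_down [] A x (A.length + 1) [] [] (by simp) (by simp)
    simp only [List.append_nil, List.length_nil, List.nil_append] at this
    simp [ofCols_of_nil, remove, colIdx, rowIdx, List.findIdx_cons, this, dropEmpty_singleton,
      List.idxOf_append, hx]
  · have := slide_down [] A x (A.length + (B.length + 1)) [] [B] (by simp) (by simpa using hl)
    simp only [List.append_nil, List.length_nil, List.nil_append] at this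
    rw [ofCols_of_ne_nil (by simp) hB]
    simp [remove, colIdx, rowIdx, List.findIdx_cons, this, List.idxOf_append, hx, ofCols]

theorem remove_last_right {A B : List ℕ} {x : ℕ} (hxA : x ∉ A) (hxB : x ∉ B) (hA : A ≠ []) :
    (ofCols A (B ++ [x])).remove x = ofCols A B := by
  have := slide_down [] B x (A.length + (B.length + 1)) [A] [] (by simp) (by simp)
  simp only [List.append_nil, List.length_singleton, List.cons_append, List.nil_append] at this
  rw [ofCols_of_ne_nil hA (by simp)]
  simp [remove, colIdx, rowIdx, List.findIdx_cons, this, List.idxOf_append, hxA, hxB, ofCols]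

theorem exists_eq_append_of_max {L : List ℕ} {x : ℕ} (hL : L.Pairwise (· < ·)) (hx : x ∈ L)
    (hmax : ∀ y ∈ L, y ≤ x) : ∃ L₀, L = L₀ ++ [x] := by
  rcases List.eq_nil_or_concat L with rfl | ⟨L₀, y, rfl⟩
  · simp at hx
  · simp only [List.concat_eq_append, List.mem_append, List.mem_singleton,
      List.pairwise_append] at hL hx hmax ⊢
    have h1 := hmax y (Or.inr rfl)
    rcases hx with hx | rfl
    · have := hL.2.2 x hx y rfl
      omega
    · exact ⟨L₀, rfl⟩

/-! ### Windows of a tableau and distances in the tree of its path -/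

/-- `T` has at most two columns, the entries `x + 1, …, j`, and initial parts whose shapes are
given by the distances of `x` from the later times in the tree of the path `h`. -/
def IsWindow (h : ℕ → ℤ) (x j : ℕ) (T : ColArray) : Prop :=
  ∃ A B, T = ofCols A B ∧ A.Pairwise (· < ·) ∧ B.Pairwise (· < ·) ∧
    (A ++ B).Perm (List.range' (x + 1) (j - x)) ∧
    ∀ z, x ≤ z → z ≤ j → height A B z = pathDist h x z

theorem IsWindow.remove_last {h : ℕ → ℤ} {x j : ℕ} {T : ColArray} (hT : IsWindow h x (j + 1) T)
    (hxj : x ≤ j) : IsWindow h x j (T.remove (j + 1)) := by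
  obtain ⟨A, B, rfl, hA, hB, hp, hz⟩ := hT
  have hmem : ∀ y, (y ∈ A ∨ y ∈ B) ↔ (x + 1 ≤ y ∧ y ≤ j + 1) := fun y => by
    rw [← List.mem_append, hp.mem_iff, List.mem_range'_1]
    omega
  have hnd : (A ++ B).Nodup := hp.nodup_iff.2 List.nodup_range'
  have hr : List.range' (x + 1) (j + 1 - x) = List.range' (x + 1) (j - x) ++ [j + 1] := by
    rw [show j + 1 - x = (j - x) + 1 by omega, List.range'_1_concat]
    congr 2
    omega
  rw [hr] at hp
  rcases (hmem (j + 1)).2 (by omega) with hj | hj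
  · obtain ⟨A, rfl⟩ := exists_eq_append_of_max hA hj fun y hy => ((hmem y).1 (Or.inl hy)).2
    have hjA : j + 1 ∉ A := fun hm => by
      have := (List.pairwise_append.1 hA).2.2 _ hm (j + 1) (by simp)
      omega
    have hjB : j + 1 ∉ B := (List.disjoint_of_nodup_append hnd) hj
    have hA' : ∀ y ∈ A, y ≤ j := fun y hy => by
      have := (hmem y).1 (Or.inl (by simp [hy]))
      have : y ≠ j + 1 := by rintro rfl; exact hjA hy
      omega
    have hB' : ∀ y ∈ B, y ≤ j := fun y hy => by
      have := (hmem y).1 (Or.inr hy)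
      have : y ≠ j + 1 := by rintro rfl; exact hjB hy
      omega
    have hz' : ∀ z, x ≤ z → z ≤ j → height A B z = pathDist h x z := fun z h1 h2 => by
      rw [← hz z h1 (by omega)]
      simp only [height, countLE_append, countLE_cons, countLE_nil]
      rw [if_neg (by omega)]
      omega
    have hlen := hz' j hxj le_rfl
    have := pathDist_nonneg h hxj
    rw [height, countLE_eq_length hA', countLE_eq_length hB'] at hlen
    refine ⟨A, B, remove_last_left hjA (by omega), (List.pairwise_append.1 hA).1, hB, ?_, hz'⟩
    rw [List.append_assoc] at hp
    refine (List.perm_append_right_iff [j + 1]).1 (List.Perm.trans ?_ hp)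
    rw [List.append_assoc]
    exact List.perm_append_comm.append_left A
  · obtain ⟨B, rfl⟩ := exists_eq_append_of_max hB hj fun y hy => ((hmem y).1 (Or.inr hy)).2
    have hjB : j + 1 ∉ B := fun hm => by
      have := (List.pairwise_append.1 hB).2.2 _ hm (j + 1) (by simp)
      omega
    have hjA : j + 1 ∉ A := fun hm => (List.disjoint_of_nodup_append hnd) hm hj
    have hne : A ≠ [] := by
      rintro rfl
      have h1 := hz (j + 1) (by omega) le_rfl
      have := pathDist_nonneg h (show x ≤ j + 1 by omega)
      have := countLE_nonneg B (j + 1)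
      simp only [height, countLE_append, countLE_cons, countLE_nil, le_refl, if_true] at h1
      omega
    refine ⟨A, B, remove_last_right hjA hjB hne, hA, (List.pairwise_append.1 hB).1, ?_,
      fun z h1 h2 => ?_⟩
    · rw [← List.append_assoc] at hp
      exact (List.perm_append_right_iff [j + 1]).1 hp
    · rw [← hz z h1 (by omega)]
      simp only [height, countLE_append, countLE_cons, countLE_nil]
      rw [if_neg (by omega)]
      omega

theorem IsWindow.remove_first {n : ℕ} {h : ℕ → ℤ} (hs : UnitSteps n h) {x j : ℕ} {T : ColArray}
    (hT : IsWindow h x j T) (hxj : x < j) (hj : j ≤ n) :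
    IsWindow h (x + 1) j (T.remove (x + 1)) := by
  obtain ⟨A, B, rfl, hA, hB, hp, hz⟩ := hT
  have hmem : ∀ y, (y ∈ A ∨ y ∈ B) ↔ (x + 1 ≤ y ∧ y ≤ j) := fun y => by
    rw [← List.mem_append, hp.mem_iff, List.mem_range'_1]
    omega
  have hr : List.range' (x + 1) (j - x) = (x + 1) :: List.range' (x + 2) (j - (x + 1)) := by
    rw [show j - x = (j - (x + 1)) + 1 by omega, List.range'_succ]
  rw [hr] at hp
  -- The least entry heads the left column: in the right one it would make the height at `x + 1`
  -- negative.
  obtain ⟨A, rfl⟩ : ∃ A', A = (x + 1) :: A' := by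
    have h1 := hz (x + 1) (by omega) hxj
    have h2 := pathDist_nonneg h (show x ≤ x + 1 by omega)
    have hmA : x + 1 ∈ A := by
      rcases (hmem (x + 1)).2 (by omega) with h3 | h3
      · exact h3
      have hndA := hp.nodup_iff.2 (hr ▸ List.nodup_range')
      have hnA : x + 1 ∉ A := fun hm => (List.disjoint_of_nodup_append hndA) hm h3
      have hA0 : countLE A (x + 1) = 0 := countLE_eq_zero fun y hy => by
        have := (hmem y).1 (Or.inl hy)
        have : y ≠ x + 1 := by rintro rfl; exact hnA hy
        omega
      have hB0 := countLE_succ B x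
      have := countLE_nonneg B x
      have := List.count_pos_iff.2 h3
      rw [height] at h1
      omega
    cases A with
    | nil => simp at hmA
    | cons a A =>
      have := (hmem a).1 (Or.inl (by simp))
      rcases List.mem_cons.1 hmA with h3 | h3
      · exact ⟨A, by rw [h3]⟩
      · have := (List.pairwise_cons.1 hA).1 _ h3
        omega
  rw [List.pairwise_cons] at hA
  refine ⟨_, _, remove_head _ _ _, refill_fst_pairwise hA.2 hB,
    hB.sublist (refill_snd_sublist A B), (refill_perm A B).trans ?_, fun z h1 h2 => ?_⟩
  · rw [List.cons_append] at hp
    exact (List.perm_cons _).1 hp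
  · classical
    have hht : ∀ w, x + 1 ≤ w → w ≤ j → height A B w = pathDist h x w - 1 := fun w hw hw' => by
      rw [← hz w (by omega) hw']
      simp only [height, countLE_cons]
      rw [if_pos hw]
      omega
    -- Without its head the left column gives the distance minus `1`. So the height `-1` means
    -- distance `0`, that is, a return of the path to its level at `x`.
    have hiff : (∃ w ≤ z, height A B w = -1) ↔ ∃ k ≤ z, IsArc h x k := by
      constructor
      · rintro ⟨w, hw, hw1⟩
        have hxw : x + 1 ≤ w := by
          by_contra hlt
          have hB0 : countLE B w = 0 := countLE_eq_zero fun y hy => by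
            have := (hmem y).1 (Or.inr hy)
            omega
          have := countLE_nonneg A w
          rw [height] at hw1
          omega
        rw [hht w hxw (by omega)] at hw1
        obtain ⟨h3, h4⟩ := (pathDist_eq_zero_iff h (show x ≤ w by omega)).1 (by omega)
        have h5 := h4 (x + 1) (by omega) hxw
        have h6 := hs x (by omega)
        obtain ⟨k, hk, hk'⟩ := hs.exists_isArc_right (x := x) (y := w) (by omega) (by omega)
          (by omega) h3.le
        exact ⟨k, by omega, hk'⟩
      · rintro ⟨k, hk, hxk, hk1, hk2⟩
        refine ⟨k, hk, ?_⟩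
        rw [hht k hxk (by omega), (pathDist_eq_zero_iff h hxk.le).2 ⟨hk1, fun v hv hv' => ?_⟩]
        · rfl
        rcases Nat.eq_or_lt_of_le hv with rfl | hv
        · exact le_rfl
        rcases Nat.eq_or_lt_of_le hv' with rfl | hv'
        · exact hk1.ge
        · exact (hk2 v hv hv').le
    rw [height_refill hA.2 hB, hht z h1 h2, hs.pathDist_eq_succ (x := x) (by omega) (by omega)]
    simp only [hiff]
    split_ifs <;> omega

theorem IsWindow.foldl_remove_last {h : ℕ → ℤ} {x j d : ℕ} {T : ColArray} (hxj : x ≤ j)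
    (hT : IsWindow h x (j + d) T) :
    IsWindow h x j ((List.range' (j + 1) d).reverse.foldl remove T) := by
  induction d generalizing T with
  | zero => simpa using hT
  | succ d ih =>
    rw [List.range'_1_concat, List.reverse_append, List.reverse_singleton, List.singleton_append,
      List.foldl_cons, show j + 1 + d = j + d + 1 by omega]
    exact ih (IsWindow.remove_last hT (by omega))

theorem IsWindow.foldl_remove_first {n : ℕ} {h : ℕ → ℤ} (hs : UnitSteps n h) {j d : ℕ}
    {T : ColArray} (hj : j ≤ n) (hd : d ≤ j) (hT : IsWindow h 0 j T) :
    IsWindow h d j ((List.range' 1 d).foldl remove T) := by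
  induction d with
  | zero => simpa using hT
  | succ d ih =>
    rw [List.range'_1_concat, List.foldl_append, List.foldl_cons, List.foldl_nil, add_comm 1 d]
    exact (ih (by omega)).remove_first hs (by omega) hj

theorem IsWindow.proj {n : ℕ} {h : ℕ → ℤ} (hs : UnitSteps n h) {T : ColArray}
    (hT : IsWindow h 0 n T) {x j : ℕ} (hxj : x < j) (hj : j ≤ n) :
    IsWindow h x j (T.proj n (x + 1) j) := by
  rw [ColArray.proj, List.foldl_append]
  refine IsWindow.foldl_remove_first hs hj hxj.le (IsWindow.foldl_remove_last (Nat.zero_le j) ?_)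
  rwa [show j + (n - j) = n by omega]

theorem sum_take_shape_ofCols {A B : List ℕ} (hl : B.length ≤ A.length) (k : ℕ) :
    ((ofCols A B).shape.take k).sum =
      if k = 0 then 0 else if k = 1 then A.length else A.length + B.length := by
  rcases k with _ | _ | k <;> cases A <;> cases B <;> simp_all [ofCols, dropEmpty, shape]

/-- Both shapes have at most two parts and the same size, so only the first parts matter, and these
are determined by the differences of the parts. -/
theorem IsWindow.dominanceLE_iff {g h : ℕ → ℤ} {x j : ℕ} {T S : ColArray}
    (hT : IsWindow g x j T) (hS : IsWindow h x j S) (hxj : x ≤ j) :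
    DominanceLE T.shape S.shape ↔ pathDist g x j ≤ pathDist h x j := by
  have key : ∀ {g : ℕ → ℤ} {T : ColArray}, IsWindow g x j T → ∃ A B, T = ofCols A B ∧
      B.length ≤ A.length ∧ A.length + B.length = j - x ∧
      (A.length : ℤ) - B.length = pathDist g x j := by
    rintro g T ⟨A, B, rfl, -, -, hp, hz⟩
    have h1 := hz j hxj le_rfl
    have hmem : ∀ y, (y ∈ A ∨ y ∈ B) → y ≤ j := fun y hy => by
      rw [← List.mem_append, hp.mem_iff, List.mem_range'_1] at hy
      omega
    rw [height, countLE_eq_length fun y hy => hmem y (Or.inl hy),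
      countLE_eq_length fun y hy => hmem y (Or.inr hy)] at h1
    have h2 := hp.length_eq
    rw [List.length_append, List.length_range'] at h2
    have := pathDist_nonneg g hxj
    exact ⟨A, B, rfl, by omega, h2, h1⟩
  obtain ⟨A, B, rfl, h1, h2, h3⟩ := key hT
  obtain ⟨A', B', rfl, h1', h2', h3'⟩ := key hS
  simp only [DominanceLE, sum_take_shape_ofCols h1, sum_take_shape_ofCols h1']
  constructor
  · intro hk
    have := hk 1
    simp at this
    omega
  · intro hle k
    split_ifs <;> omega

/-! ### The canonical word read off the columns -/

/-- The canonical word of the tableau whose columns, read from bottom to top, are the arguments. -/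
def popWord : List ℕ → List ℕ → List ℕ
  | A, [] => A
  | [], _ :: _ => []
  | a :: A, b :: B => if a < b then a :: b :: popWord A B else a :: popWord A (b :: B)

/-- The lists `A` and `B` are the columns of a standard tableau, read from bottom to top. -/
structure IsColPair (A B : List ℕ) : Prop where
  left : A.Pairwise (· > ·)
  right : B.Pairwise (· > ·)
  disjoint : ∀ x ∈ A, x ∉ B
  le : ∀ z, countLE B z ≤ countLE A z

theorem IsColPair.tail_tail {a b : ℕ} {A B : List ℕ} (h : IsColPair (a :: A) (b :: B))
    (hab : a < b) : IsColPair A B := by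
  obtain ⟨h1, h2, h3, h4⟩ := h
  rw [List.pairwise_cons] at h1 h2
  refine ⟨h1.2, h2.2, fun x hx hx' => h3 x (by simp [hx]) (by simp [hx']), fun z => ?_⟩
  have h5 := h4 z
  have h6 := h4 b
  rw [countLE_cons, countLE_cons] at h5 h6
  rw [if_pos le_rfl, if_pos hab.le, countLE_eq_length (A := A) fun x hx => by
      have := h1.1 x hx; omega,
    countLE_eq_length (A := B) fun x hx => by have := h2.1 x hx; omega] at h6
  have h7 := countLE_le_length B z
  rcases lt_or_ge z a with hz | hz
  · rw [if_neg (show ¬ a ≤ z by omega), if_neg (show ¬ b ≤ z by omega)] at h5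
    omega
  · rw [countLE_eq_length (A := A) fun x hx => by have := h1.1 x hx; omega]
    omega

theorem IsColPair.tail_left {a b : ℕ} {A B : List ℕ} (h : IsColPair (a :: A) (b :: B))
    (hab : b < a) : IsColPair A (b :: B) := by
  obtain ⟨h1, h2, h3, h4⟩ := h
  have h2' := h2
  rw [List.pairwise_cons] at h1 h2
  have hB : ∀ x ∈ b :: B, x < a := fun x hx => by
    rcases List.mem_cons.1 hx with rfl | hx
    · exact hab
    · have := h2.1 x hx
      omega
  refine ⟨h1.2, h2', fun x hx hx' => h3 x (by simp [hx]) hx', fun z => ?_⟩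
  rcases lt_or_ge z a with hz | hz
  · have h5 := h4 z
    rw [countLE_cons a A, if_neg (show ¬ a ≤ z by omega)] at h5
    omega
  · have h5 := h4 (a - 1)
    rw [countLE_cons a A, if_neg (show ¬ a ≤ a - 1 by omega),
      countLE_eq_length (A := A) fun x hx => by have := h1.1 x hx; omega,
      countLE_eq_length (A := b :: B) fun x hx => by have := hB x hx; omega] at h5
    rw [countLE_eq_length (A := A) fun x hx => by have := h1.1 x hx; omega]
    have := countLE_le_length (b :: B) z
    omega

theorem IsColPair.tail_nil {a : ℕ} {A : List ℕ} (h : IsColPair (a :: A) []) : IsColPair A [] :=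
  ⟨(List.pairwise_cons.1 h.left).2, h.right, by simp, fun z => by
    simpa [countLE_nil] using countLE_nonneg A z⟩

theorem IsColPair.not_nil_cons {b : ℕ} {B : List ℕ} (h : IsColPair [] (b :: B)) : False := by
  have h1 := h.le b
  have := countLE_nonneg B b
  rw [countLE_cons, countLE_nil, if_pos le_rfl] at h1
  omega

theorem IsColPair.lt_of_not_lt {a b : ℕ} {A B : List ℕ} (h : IsColPair (a :: A) (b :: B))
    (hab : ¬ a < b) : b < a := by
  have : a ≠ b := by
    rintro rfl
    exact h.disjoint a (by simp) (by simp)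
  omega

theorem popWord_perm {A B : List ℕ} (h : IsColPair A B) : (popWord A B).Perm (A ++ B) := by
  fun_induction popWord A B with
  | case1 A => simp
  | case2 b B => exact h.not_nil_cons.elim
  | case3 a A b B hab ih =>
    simp only [List.cons_append, List.perm_cons]
    exact ((ih (h.tail_tail hab)).cons b).trans List.perm_middle.symm
  | case4 a A b B hab ih =>
    simpa using ih (h.tail_left (h.lt_of_not_lt hab))

theorem largest_eq {L : List ℕ} {x : ℕ} (hx : x ∈ L) (hmax : ∀ y ∈ L, y ≤ x) :
    largest L = x := by
  have h1 : ∀ L : List ℕ, (∀ y ∈ L, y ≤ x) → largest L ≤ x := by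
    intro L
    induction L with
    | nil => simp [largest]
    | cons a L ih =>
      intro h
      exact max_le (h a (by simp)) (ih fun y hy => h y (by simp [hy]))
  have h2 : ∀ L : List ℕ, x ∈ L → x ≤ largest L := by
    intro L
    induction L with
    | nil => simp
    | cons a L ih =>
      intro h
      rcases List.mem_cons.1 h with rfl | h
      · exact le_max_left _ _
      · exact (ih h).trans (le_max_right _ _)
  exact le_antisymm (h1 L hmax) (h2 L hx)

theorem mem_flatten_ofCols {A B : List ℕ} {x : ℕ} : x ∈ (ofCols A B).flatten ↔ x ∈ A ∨ x ∈ B := by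
  cases A <;> cases B <;> simp [ofCols, dropEmpty, or_assoc]

theorem deleteCorner_left {A B : List ℕ} {x : ℕ} (hx : x ∉ A) :
    (ofCols (A ++ [x]) B).deleteCorner x = (ofCols A B, x) := by
  rcases eq_or_ne B [] with rfl | hB
  · rw [ofCols_of_nil (by simp)]
    simp [deleteCorner, colIdx, List.findIdx_cons, pushLeft, List.erase_append_right _ hx,
      dropEmpty_singleton]
  · rw [ofCols_of_ne_nil (by simp) hB]
    simp [deleteCorner, colIdx, List.findIdx_cons, pushLeft, List.erase_append_right _ hx, ofCols]

theorem pushCol_append {A : List ℕ} {a b : ℕ} (hA : ∀ x ∈ A, x < a) (hab : a < b) :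
    pushCol (A ++ [a]) b = (A ++ [b], a) := by
  have hf : (A ++ [a]).filter (fun x => x < b) = A ++ [a] := by
    rw [List.filter_eq_self]
    intro x hx
    rcases List.mem_append.1 hx with hx | hx
    · simpa using (hA x hx).trans hab
    · simp only [List.mem_singleton] at hx
      simpa [hx] using hab
  have hl : largest (A ++ [a]) = a := largest_eq (by simp) fun y hy => by
    rcases List.mem_append.1 hy with hy | hy
    · exact (hA y hy).le
    · simp only [List.mem_singleton] at hy
      exact hy.le
  have haA : a ∉ A := fun h => lt_irrefl _ (hA a h)
  simp [pushCol, hf, hl, List.replace_append_right haA]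

theorem deleteCorner_right {A B : List ℕ} {a b : ℕ} (hA : ∀ x ∈ A, x < a) (hab : a < b)
    (hB : b ∉ B) :
    (ofCols (A ++ [a]) (B ++ [b])).deleteCorner b = (ofCols (A ++ [b]) B, a) := by
  have hbA : b ∉ A := fun h => by
    have := hA b h
    omega
  rw [ofCols_of_ne_nil (by simp) (by simp)]
  simp [deleteCorner, colIdx, List.findIdx_cons, pushLeft, pushCol_append hA hab,
    List.erase_append_right _ hB, hbA, hab.ne', ofCols]

/-- If the largest entry `b` is in the right column, its deletion pushes out the foot `a` of the
left column and puts `b` there; the next round takes `b` away. These two rounds are one step `a :: b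
:: _` of `popWord`. -/
theorem deletionWord_ofCols {A B : List ℕ} (h : IsColPair A B) :
    deletionWord (A.length + B.length) (ofCols A.reverse B.reverse) = popWord A B := by
  have left : ∀ (m a : ℕ) (A B : List ℕ), (∀ x ∈ A, x < a) → (∀ x ∈ B, x < a) →
      deletionWord (m + 1) (ofCols (A.reverse ++ [a]) B.reverse) =
        a :: deletionWord m (ofCols A.reverse B.reverse) := by
    intro m a A B hA hB
    have hl : largest (ofCols (A.reverse ++ [a]) B.reverse).flatten = a := by
      refine largest_eq (mem_flatten_ofCols.2 (by simp)) fun y hy => ?_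
      simp only [mem_flatten_ofCols, List.mem_append, List.mem_reverse, List.mem_singleton] at hy
      rcases hy with (hy | rfl) | hy
      · exact (hA y hy).le
      · exact le_rfl
      · exact (hB y hy).le
    have haA : a ∉ A.reverse := fun h => lt_irrefl _ (hA a (List.mem_reverse.1 h))
    rw [deletionWord, hl, deleteCorner_left haA]
  fun_induction popWord A B with
  | case1 A =>
    induction A with
    | nil => rfl
    | cons a A ih =>
      rw [List.reverse_cons, List.length_cons, add_right_comm,
        left _ a A [] (List.pairwise_cons.1 h.left).1 (by simp), ih h.tail_nil]
  | case2 b B => exact h.not_nil_cons.elim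
  | case3 a A b B hab ih =>
    have hA := (List.pairwise_cons.1 h.left).1
    have hB := (List.pairwise_cons.1 h.right).1
    have hl : largest (ofCols (A.reverse ++ [a]) (B.reverse ++ [b])).flatten = b := by
      refine largest_eq (mem_flatten_ofCols.2 (by simp)) fun y hy => ?_
      simp only [mem_flatten_ofCols, List.mem_append, List.mem_reverse, List.mem_singleton] at hy
      rcases hy with (hy | rfl) | hy | rfl
      · exact ((hA y hy).trans hab).le
      · exact hab.le
      · exact (hB y hy).le
      · exact le_rfl
    have hbB : b ∉ B.reverse := fun h => lt_irrefl _ (hB b (List.mem_reverse.1 h))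
    rw [List.reverse_cons, List.reverse_cons, List.length_cons, List.length_cons,
      show A.length + 1 + (B.length + 1) = A.length + B.length + 1 + 1 by omega, deletionWord, hl,
      deleteCorner_right (fun x hx => hA x (List.mem_reverse.1 hx)) hab hbB,
      left _ b A B (fun x hx => (hA x hx).trans hab) hB, ih (h.tail_tail hab)]
  | case4 a A b B hab ih =>
    have hA := (List.pairwise_cons.1 h.left).1
    have hB := (List.pairwise_cons.1 h.right).1
    have hba := h.lt_of_not_lt hab
    rw [List.reverse_cons (a := a), List.length_cons (a := a), add_right_comm,
      left _ a A (b :: B) hA ?_, ih (h.tail_left hba)]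
    intro x hx
    rcases List.mem_cons.1 hx with rfl | hx
    · exact hba
    · exact (hB x hx).trans hba

theorem canonicalWord_ofCols {A B : List ℕ} (h : IsColPair A B) :
    (ofCols A.reverse B.reverse).canonicalWord = popWord A B := by
  rw [canonicalWord, length_flatten_ofCols, List.length_reverse, List.length_reverse,
    deletionWord_ofCols h]

theorem not_idxOf_lt_of_pairwise_gt {A : List ℕ} (hA : A.Pairwise (· > ·)) {i j : ℕ} (hij : i < j)
    (hj : j ∈ A) : ¬ A.idxOf i < A.idxOf j := by
  induction A with
  | nil => simp
  | cons a A ih =>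
    rw [List.pairwise_cons] at hA
    rcases List.mem_cons.1 hj with rfl | hj
    · simp
    · have h1 := hA.1 j hj
      rw [List.idxOf_cons_ne _ (by omega), List.idxOf_cons_ne _ (by omega)]
      have := ih hA.2 hj
      omega

/-- The last condition says that, up to some time `b`, there are no more up steps from `i + 1` on
than down steps from `j + 1` on. The recursion of `popWord` strips the last up step, together with
the last down step if that comes later; the witness is adjusted each time. -/
theorem popWord_idxOf_lt_iff {A B : List ℕ} (h : IsColPair A B) {i j : ℕ} (hij : i < j)
    (hi : i + 1 ∈ A ∨ i + 1 ∈ B) (hj : j + 1 ∈ A ∨ j + 1 ∈ B) :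
    (popWord A B).idxOf (i + 1) < (popWord A B).idxOf (j + 1) ↔
      i + 1 ∈ A ∧ j + 1 ∈ B ∧
        ∃ b, j < b ∧ countLE A b - countLE A i ≤ countLE B b - countLE B j := by
  fun_induction popWord A B with
  | case1 A =>
    have hj' : j + 1 ∈ A := by simpa using hj
    simpa using not_lt.1 (not_idxOf_lt_of_pairwise_gt h.left (show i + 1 < j + 1 by omega) hj')
  | case2 b B => exact h.not_nil_cons.elim
  | case3 a A b B hab ih =>
    have hA := (List.pairwise_cons.1 h.left).1
    have hB := (List.pairwise_cons.1 h.right).1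
    have hdis := h.disjoint
    have hlA : ∀ z, a ≤ z + 1 → countLE A z = A.length := fun z hz =>
      countLE_eq_length fun x hx => by have := hA x hx; omega
    have hlB : ∀ z, b ≤ z + 1 → countLE B z = B.length := fun z hz =>
      countLE_eq_length fun x hx => by have := hB x hx; omega
    have hjb : j + 1 ≤ b := by
      simp only [List.mem_cons] at hj
      rcases hj with (hj | hj) | hj | hj
      · omega
      · have := hA _ hj; omega
      · omega
      · exact (hB _ hj).le
    rcases eq_or_ne (j + 1) a with rfl | hja
    · simp only [List.idxOf_cons_self, not_lt_zero, false_iff]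
      rintro ⟨-, h2, -⟩
      exact hdis _ (by simp) h2
    rcases eq_or_ne (i + 1) a with rfl | hia
    · have hjB : j + 1 ∈ b :: B := by
        rcases hj with hj | hj
        · rcases List.mem_cons.1 hj with hj | hj
          · exact absurd hj hja
          · have := hA _ hj
            omega
        · exact hj
      rw [List.idxOf_cons_self, List.idxOf_cons_ne _ (Ne.symm hja)]
      -- Here `i + 1` is the last up step, so the single down step `j + 1` already balances it.
      refine iff_of_true (Nat.succ_pos _) ⟨by simp, hjB, j + 1, by omega, ?_⟩
      have h1 := countLE_succ (b :: B) j
      have h2 := List.count_pos_iff.2 hjB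
      have h3 := hlA i (by omega)
      have h4 := hlA (j + 1) (by omega)
      rw [countLE_cons (i + 1), countLE_cons (i + 1), if_pos (by omega), if_neg (by omega)]
      omega
    have hib : b ≠ i + 1 := by omega
    rcases eq_or_ne (j + 1) b with rfl | hjb'
    · rw [List.idxOf_cons_ne _ (Ne.symm hia), List.idxOf_cons_ne _ (Ne.symm hja),
        List.idxOf_cons_self, List.idxOf_cons_ne _ hib]
      -- Only one down step is left from `j + 1` on, but at least two up steps, `i + 1` and `a`.
      refine iff_of_false (by omega) ?_
      rintro ⟨h1, -, c, hc, hle⟩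
      have hiA : i + 1 ∈ A := by simpa [hia] using h1
      have h2 := hA _ hiA
      have h3 := hlA c (by omega)
      have h4 := hlB c (by omega)
      have h5 := hlB j le_rfl
      have h6 := countLE_succ A i
      have h7 := List.count_pos_iff.2 hiA
      have h8 := countLE_le_length A (i + 1)
      simp only [countLE_cons] at hle
      rw [if_pos (by omega), if_neg (by omega), if_pos (by omega), if_neg (by omega)] at hle
      omega
    simp only [List.mem_cons, hia, hja, hib.symm, hjb', false_or] at hi hj ⊢
    rw [List.idxOf_cons_ne _ (Ne.symm hia), List.idxOf_cons_ne _ (Ne.symm hja),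
      List.idxOf_cons_ne _ hib, List.idxOf_cons_ne _ (Ne.symm hjb')]
    rw [Nat.succ_lt_succ_iff, Nat.succ_lt_succ_iff, ih (h.tail_tail hab) hi hj]
    refine and_congr_right fun hiA => and_congr_right fun hjB => ?_
    have h1 := hA _ hiA
    simp only [countLE_cons]
    constructor
    · rintro ⟨c, hc, hle⟩
      rcases lt_or_ge c a with hca | hca
      · refine ⟨c, hc, ?_⟩
        split_ifs <;> omega
      -- A witness `c ≥ a` may lie before `b`; it is moved to `b` so that `a` and `b` are both
      -- counted and cancel.
      · refine ⟨max c b, by omega, ?_⟩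
        have := countLE_mono B (le_max_left c b)
        have h3 := hlA c (by omega)
        have h4 := hlA (max c b) (by omega)
        split_ifs <;> omega
    · rintro ⟨c, hc, hle⟩
      refine ⟨c, hc, ?_⟩
      split_ifs at hle <;> omega
  | case4 a A b B hab ih =>
    have hba := h.lt_of_not_lt hab
    have hA := (List.pairwise_cons.1 h.left).1
    have hB : ∀ x ∈ b :: B, x < a := fun x hx => by
      rcases List.mem_cons.1 hx with rfl | hx
      · exact hba
      · exact ((List.pairwise_cons.1 h.right).1 x hx).trans hba
    have hlA : ∀ z, a ≤ z + 1 → countLE A z = A.length := fun z hz =>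
      countLE_eq_length fun x hx => by have := hA x hx; omega
    have hlB : ∀ z, a ≤ z + 1 → countLE (b :: B) z = (b :: B).length := fun z hz =>
      countLE_eq_length fun x hx => by have := hB x hx; omega
    have hja' : j + 1 ≤ a := by
      rcases hj with hj | hj
      · rcases List.mem_cons.1 hj with hj | hj
        · exact hj.le
        · exact (hA _ hj).le
      · exact (hB _ hj).le
    rcases eq_or_ne (j + 1) a with rfl | hja
    · simp only [List.idxOf_cons_self, not_lt_zero, false_iff]
      rintro ⟨-, h2, -⟩
      exact h.disjoint _ (by simp) h2
    have hia : i + 1 ≠ a := by omega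
    rw [List.mem_cons, or_iff_right hia] at hi ⊢
    rw [List.mem_cons, or_iff_right hja] at hj
    rw [List.idxOf_cons_ne _ (Ne.symm hia), List.idxOf_cons_ne _ (Ne.symm hja),
      Nat.succ_lt_succ_iff, ih (h.tail_left hba) hi hj]
    refine and_congr_right fun hiA => and_congr_right fun hjB => ?_
    have h1 := hB _ hjB
    simp only [countLE_cons a A]
    constructor
    · rintro ⟨c, hc, hle⟩
      rcases lt_or_ge c a with hca | hca
      · refine ⟨c, hc, ?_⟩
        split_ifs <;> omega
      -- All other entries are below `a`, so moving the witness back to `a - 1` only avoids counting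
      -- `a`.
      · refine ⟨a - 1, by omega, ?_⟩
        have h3 := hlA c (by omega)
        have h4 := hlA (a - 1) (by omega)
        have h5 := hlB c (by omega)
        have h6 := hlB (a - 1) (by omega)
        split_ifs <;> omega
    · rintro ⟨c, hc, hle⟩
      refine ⟨c, hc, ?_⟩
      split_ifs at hle <;> omega

/-! ### Standard tableaux as ballot paths, and the two orders -/

/-- The lists `A` and `B` are the columns of a standard tableau with `n` boxes. -/
structure IsStandardPair (n : ℕ) (A B : List ℕ) : Prop where
  left : A.Pairwise (· < ·)
  right : B.Pairwise (· < ·)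
  perm : (A ++ B).Perm (List.range' 1 n)
  le : ∀ z, countLE B z ≤ countLE A z

theorem countLE_le_of_rows {A B : List ℕ}
    (h : ∀ (r y : ℕ), B[r]? = some y → ∃ x, A[r]? = some x ∧ x < y) (z : ℕ) :
    countLE B z ≤ countLE A z := by
  induction B generalizing A with
  | nil => exact countLE_nonneg A z
  | cons b B ih =>
    cases A with
    | nil => simpa using h 0 b
    | cons a A =>
      have h0 := h 0 b rfl
      simp only [List.getElem?_cons_zero, Option.some.injEq, exists_eq_left'] at h0
      have := ih fun r y hr => by simpa using h (r + 1) y (by simpa using hr)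
      rw [countLE_cons, countLE_cons]
      split_ifs <;> omega

theorem IsStandard.exists_isStandardPair {n : ℕ} {T : ColArray} (hT : T.IsStandard n)
    (hT2 : T.length ≤ 2) : ∃ A B, T = ofCols A B ∧ IsStandardPair n A B := by
  obtain ⟨⟨h1, h2⟩, h3⟩ := hT
  match T, hT2 with
  | [], _ => exact ⟨[], [], rfl, by simp, by simp, by simpa using h3, fun z => le_rfl⟩
  | [A], _ =>
    refine ⟨A, [], (ofCols_of_nil (h1 A (by simp)).1).symm, (h1 A (by simp)).2, by simp,
      by simpa using h3, countLE_nonneg A⟩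
  | [A, B], _ =>
    refine ⟨A, B, (ofCols_of_ne_nil (h1 A (by simp)).1 (h1 B (by simp)).1).symm,
      (h1 A (by simp)).2, (h1 B (by simp)).2, by simpa using h3, countLE_le_of_rows fun r y hr => ?_⟩
    simpa [entry?] using h2 r 0 y (by simpa [entry?] using hr)

namespace IsStandardPair

variable {n : ℕ} {A B A' B' : List ℕ}

theorem mem_iff (h : IsStandardPair n A B) (x : ℕ) : (x ∈ A ∨ x ∈ B) ↔ 1 ≤ x ∧ x ≤ n := by
  rw [← List.mem_append, h.perm.mem_iff, List.mem_range'_1]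
  omega

theorem nodup (h : IsStandardPair n A B) : (A ++ B).Nodup := h.perm.nodup_iff.2 List.nodup_range'

theorem isBallot (h : IsStandardPair n A B) : IsBallot n (countLE A) (countLE B) where
  left_zero := countLE_eq_zero fun x hx => ((h.mem_iff x).1 (Or.inl hx)).1
  right_zero := countLE_eq_zero fun x hx => ((h.mem_iff x).1 (Or.inr hx)).1
  step k hk := by
    have h1 := List.count_eq_one_of_mem h.nodup
      (List.mem_append.2 ((h.mem_iff (k + 1)).2 ⟨by omega, hk⟩))
    rw [List.count_append] at h1
    have h2 := countLE_succ A k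
    have h3 := countLE_succ B k
    omega
  le k _ := h.le k

/-- A ballot path has its minimum `0` at time `0`, so the distance from `0` is the height itself. -/
theorem isWindow (h : IsStandardPair n A B) :
    IsWindow (countLE A - countLE B) 0 n (ofCols A B) := by
  refine ⟨A, B, rfl, h.left, h.right, h.perm, fun z _ hz => ?_⟩
  obtain ⟨w, -, -, h3, h4⟩ := exists_pathDist_eq (countLE A - countLE B) (Nat.zero_le z)
  have h5 := h3 0 le_rfl (Nat.zero_le z)
  have h6 := h.isBallot.left_zero
  have h7 := h.isBallot.right_zero
  have h8 := h.le w
  simp only [Pi.sub_apply] at h4 h5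
  rw [height]
  omega

theorem isColPair (h : IsStandardPair n A B) : IsColPair A.reverse B.reverse where
  left := List.pairwise_reverse.2 h.left
  right := List.pairwise_reverse.2 h.right
  disjoint x hx hx' :=
    List.disjoint_of_nodup_append h.nodup (List.mem_reverse.1 hx) (List.mem_reverse.1 hx')
  le z := by
    rw [countLE_perm (List.reverse_perm A), countLE_perm (List.reverse_perm B)]
    exact h.le z

theorem canonicalWord_eq (h : IsStandardPair n A B) :
    (ofCols A B).canonicalWord = popWord A.reverse B.reverse := by
  rw [← canonicalWord_ofCols h.isColPair, List.reverse_reverse, List.reverse_reverse]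

theorem isPermWord (h : IsStandardPair n A B) : IsPermWord n (ofCols A B).canonicalWord := by
  rw [h.canonicalWord_eq]
  exact (popWord_perm h.isColPair).trans
    (((List.reverse_perm A).append (List.reverse_perm B)).trans h.perm)

theorem up_iff (h : IsStandardPair n A B) (k : ℕ) :
    countLE A (k + 1) = countLE A k + 1 ↔ k + 1 ∈ A := by
  have h1 := countLE_succ A k
  have h2 := List.nodup_iff_count_le_one.1 h.nodup.of_append_left (k + 1)
  rw [← List.count_pos_iff]
  omega

theorem down_iff (h : IsStandardPair n A B) (k : ℕ) :
    countLE B (k + 1) = countLE B k + 1 ↔ k + 1 ∈ B := by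
  have h1 := countLE_succ B k
  have h2 := List.nodup_iff_count_le_one.1 h.nodup.of_append_right (k + 1)
  rw [← List.count_pos_iff]
  omega

theorem idxOf_lt_iff (h : IsStandardPair n A B) {i j : ℕ} (hij : i < j) (hj : j < n) :
    (ofCols A B).canonicalWord.idxOf (i + 1) < (ofCols A B).canonicalWord.idxOf (j + 1) ↔
      NonInv n (countLE A) (countLE B) i j := by
  have hmem : ∀ k < n, k + 1 ∈ A.reverse ∨ k + 1 ∈ B.reverse := fun k hk => by
    rw [List.mem_reverse, List.mem_reverse, h.mem_iff]
    omega
  rw [h.canonicalWord_eq, popWord_idxOf_lt_iff h.isColPair hij (hmem i (by omega)) (hmem j hj),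
    NonInv, h.up_iff, h.down_iff]
  simp only [countLE_perm (List.reverse_perm A), countLE_perm (List.reverse_perm B),
    List.mem_reverse, hij, hj, true_and]
  refine and_congr_right fun _ => and_congr_right fun _ => ⟨?_, ?_⟩
  · rintro ⟨b, hb, hle⟩
    rcases le_or_gt b n with hbn | hbn
    · exact ⟨b, hb, hbn, hle⟩
    -- Nothing is counted after time `n`, so a later witness can be replaced by `n`.
    · have hlen : ∀ z, n ≤ z → countLE A z = A.length ∧ countLE B z = B.length := fun z hz =>
        ⟨countLE_eq_length fun x hx => ((h.mem_iff x).1 (Or.inl hx)).2.trans hz,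
          countLE_eq_length fun x hx => ((h.mem_iff x).1 (Or.inr hx)).2.trans hz⟩
      have h1 := hlen n le_rfl
      have h2 := hlen b hbn.le
      exact ⟨n, hj, le_rfl, by omega⟩
  · rintro ⟨b, hb, -, hle⟩
    exact ⟨b, hb, hle⟩

theorem chainLE_iff (h : IsStandardPair n A B) (h' : IsStandardPair n A' B') :
    ChainLE n (ofCols A B) (ofCols A' B') ↔
      Agree n (countLE A) (countLE B) (countLE A') (countLE B') := by
  have key : ∀ x z, x < z → z ≤ n →
      (DominanceLE ((ofCols A B).proj n (x + 1) z).shape ((ofCols A' B').proj n (x + 1) z).shape ↔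
        pathDist (countLE A - countLE B) x z ≤ pathDist (countLE A' - countLE B') x z) :=
    fun x z hx hz => (h.isWindow.proj h.isBallot.unitSteps hx hz).dominanceLE_iff
      (h'.isWindow.proj h'.isBallot.unitSteps hx hz) hx.le
  constructor
  · intro hc
    exact h.isBallot.agree_of_pathDist_le
      (fun x z hx hz => (key x z (by omega) hz).1 (hc (x + 1) z (by omega) hx hz)) h'.isBallot
  · intro ha i j hi hij hj
    obtain ⟨i, rfl⟩ : ∃ x, i = x + 1 := ⟨i - 1, by omega⟩
    exact (key i j (by omega) hj).2 (h.isBallot.unitSteps.pathDist_le h'.isBallot.unitSteps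
      (fun x y hy => h.isBallot.isArc_of_agree h'.isBallot ha hy) (by omega) hj)

theorem weakLE_iff (h : IsStandardPair n A B) (h' : IsStandardPair n A' B') :
    WeakLE n (ofCols A B).canonicalWord (ofCols A' B').canonicalWord ↔
      Agree n (countLE A) (countLE B) (countLE A') (countLE B') := by
  have hne : ∀ {A B : List ℕ}, IsStandardPair n A B → ∀ i j, i < j → j < n →
      (ofCols A B).canonicalWord.idxOf (i + 1) ≠ (ofCols A B).canonicalWord.idxOf (j + 1) := by
    intro A B h i j hij hj heq
    have hi : i + 1 ∈ (ofCols A B).canonicalWord := by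
      rw [h.isPermWord.mem_iff, List.mem_range'_1]
      omega
    have := (List.idxOf_inj hi).1 heq
    omega
  constructor
  · rintro ⟨-, -, hw⟩
    refine IsBallot.agree_of_nonInv h'.isBallot fun i j hN => ?_
    have hij := hN.1
    have hj := hN.2.1
    rw [← h'.idxOf_lt_iff hij hj] at hN
    rw [← h.idxOf_lt_iff hij hj]
    have h1 := hw (i + 1) (j + 1) (by omega) (by omega) (by omega)
    have h2 := hne h i j hij hj
    omega
  · intro ha
    refine ⟨h.isPermWord, h'.isPermWord, fun i j hi hij hj hlt => ?_⟩
    obtain ⟨i, rfl⟩ : ∃ x, i = x + 1 := ⟨i - 1, by omega⟩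
    obtain ⟨j, rfl⟩ : ∃ x, j = x + 1 := ⟨j - 1, by omega⟩
    have h1 := hne h' i j (by omega) (by omega)
    by_contra hcon
    have h2 := (h'.idxOf_lt_iff (show i < j by omega) (by omega)).1 (by omega)
    have h3 := (h.idxOf_lt_iff (show i < j by omega) (by omega)).2
      (h.isBallot.nonInv_of_agree h'.isBallot ha h2)
    omega

theorem right_subset_of_agree (h : IsStandardPair n A B) (h' : IsStandardPair n A' B')
    (ha : Agree n (countLE A) (countLE B) (countLE A') (countLE B')) : ∀ x ∈ B', x ∈ B := by
  intro x hx
  have h1 := (h'.mem_iff x).1 (Or.inr hx)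
  obtain ⟨x, rfl⟩ : ∃ y, x = y + 1 := ⟨x - 1, by omega⟩
  obtain ⟨k, hk⟩ := h'.isBallot.exists_isArc_of_down (y := x) (by omega) ((h'.down_iff x).2 hx)
  exact (h.down_iff x).1 (ha k x (by omega) hk).2

/-- Every down step is matched, so agreement in both directions gives the two right columns the same
entries; the left columns are their complements. -/
theorem eq_of_agree (h : IsStandardPair n A B) (h' : IsStandardPair n A' B')
    (ha : Agree n (countLE A) (countLE B) (countLE A') (countLE B'))
    (ha' : Agree n (countLE A') (countLE B') (countLE A) (countLE B)) : A = A' ∧ B = B' := by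
  have hB : ∀ x, x ∈ B ↔ x ∈ B' := fun x =>
    ⟨right_subset_of_agree h' h ha' x, right_subset_of_agree h h' ha x⟩
  have mem_left : ∀ {A B : List ℕ}, IsStandardPair n A B → ∀ x,
      x ∈ A ↔ (1 ≤ x ∧ x ≤ n) ∧ x ∉ B := fun h x => by
    have h1 := h.mem_iff x
    have h2 : x ∈ _ → x ∉ _ := fun hA hB => List.disjoint_of_nodup_append h.nodup hA hB
    tauto
  have hA : ∀ x, x ∈ A ↔ x ∈ A' := fun x => by rw [mem_left h, mem_left h', hB]
  exact ⟨h.left.eq_of_mem_iff h'.left hA, h.right.eq_of_mem_iff h'.right hB⟩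

end IsStandardPair

end ColArray

theorem theorem3p5 (n : ℕ) (T S : ColArray)
    (hT : T.IsStandard n) (hT2 : T.length ≤ 2)
    (hS : S.IsStandard n) (hS2 : S.length ≤ 2) :
    ColArray.ChainLT n T S ↔ WeakLT n T.canonicalWord S.canonicalWord := by
  obtain ⟨A, B, rfl, h⟩ := hT.exists_isStandardPair hT2
  obtain ⟨A', B', rfl, h'⟩ := hS.exists_isStandardPair hS2
  rw [ColArray.ChainLT, WeakLT, h.chainLE_iff h', h.weakLE_iff h']
  refine and_congr_right fun ha => not_congr ⟨fun he => by rw [he], fun he => ?_⟩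
  -- Equal words are also comparable the other way round, which yields the reverse agreement.
  have hw : WeakLE n (ColArray.ofCols A' B').canonicalWord (ColArray.ofCols A B).canonicalWord := by
    rw [he]
    exact ⟨h'.isPermWord, h'.isPermWord, fun _ _ _ _ _ hlt => hlt⟩
  obtain ⟨rfl, rfl⟩ := h.eq_of_agree h' ha ((h'.weakLE_iff h).1 hw)
  rfl
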